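/- A positive integer $m$ is a *Hall divisor* of an integer $n\ge 1$ if $m\mid n$ and $\gcd(m,n/m)=1$. A positive integer $m$ is a *Hall number* if every finite group $G$ such that $m$ is a Hall divisor of $|G|$ has a subgroup of order $m$. (i) Let $m=ab$, where $a,b>2$ are integers with $\gcd(a,b)=1$. Assume that $m\notin\{12,24,60\}$ and that $m$ is not twice an odd number (that is, $m\not\equiv 2\pmod 4$). Then there is a prime $p$ such that $m$ is a Hall divisor of $|\mathrm{PSL}_2(p)|$, but $\mathrm{PSL}_2(p)$ has no subgroup of order $m$. Here $\mathrm{PSL}_2(p)=\mathrm{SL}_2(\mathbb{F}_p)/Z(\mathrm{SL}_2(\mathbb{F}_p))$. (ii) Consequently, every Hall number $m$ satisfies one of the following conditions: (1) $m$ is a prime power, i.e. $m=p^k$ with $p$ prime and $k\ge 0$ (so $m=1$ is included); (2) $m$ is even and $m/2$ is odd; (3) $m\in\{12,24,60\}$. -/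

import Mathlib

open scoped MatrixGroups

/-- `m` is a Hall divisor of `n`: `n` is precisely divisible by `m`, that is, `m ∣ n` and
`gcd (m, n / m) = 1`. -/
def IsHallDivisor (m n : ℕ) : Prop :=
  m ∣ n ∧ Nat.gcd m (n / m) = 1

/-- A positive integer `m` is a Hall number if every finite group whose order has `m` as a Hall
divisor has a (necessarily Hall) subgroup of order `m`. Every finite group is isomorphic to one
whose carrier is in `Type`, so quantifying over `Type` covers all finite groups. -/
def IsHallNumber (m : ℕ) : Prop :=
  0 < m ∧ ∀ (G : Type) [Group G] [Finite G],
    IsHallDivisor m (Nat.card G) → ∃ H : Subgroup G, Nat.card H = m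

/-! By Dirichlet there is a prime p with p ≡ 1 + a mod a² and p ≡ b - 1 mod b². Then a and b are
Hall divisors of p - 1 and p + 1. One of a, b is odd and the other is odd or divisible by 4, so
halving does no harm and ab is a Hall divisor of |PSL(2, p)| = p(p - 1)(p + 1)/2.

A subgroup H of order ab has order prime to p. On the projective line over the field with p²
elements, each nontrivial element of H fixes exactly two points. Counting orbits as Klein did
(`exists_stabilizer_index_le_two_or_card`), |H| is 12, 24 or 60, or some point stabilizer has index
at most 2. The preimage of that stabilizer in SL(2, p) is cyclic of order dividing p - 1 or p + 1
(`card_dvd_of_fixes`), hence so does |H|. But if ab divides p - 1 or p + 1, then b or a divides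
both, hence divides 2. -/

/-! ### Klein's orbit equation -/

/-- The numerical part of Klein's classification, for three orbit sizes `f, f', f''` with stabilizer
orders `e ≤ e' ≤ e''`. -/
lemma klein_equation_of_le {h e e' e'' f f' f'' : ℕ} (he : 2 ≤ e) (hee' : e ≤ e') (hee'' : e' ≤ e'')
    (hf : e * f = h) (hf' : e' * f' = h) (hf'' : e'' * f'' = h) (hf3 : 3 ≤ f'')
    (hsum : f + f' + f'' = h + 2) : h = 12 ∨ h = 24 ∨ h = 60 := by
  -- The equation reads 1/e + 1/e' + 1/e'' = 1 + 2/h, so the reciprocals must sum to more than 1.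
  have h1 : e < 3 := by
    by_contra! hc
    have a1 := Nat.mul_le_mul_right f hc
    have a2 := Nat.mul_le_mul_right f' (hc.trans hee')
    have a3 := Nat.mul_le_mul_right f'' (hc.trans (hee'.trans hee''))
    lia
  obtain rfl : e = 2 := by lia
  have h2 : e' < 4 := by
    by_contra! hc
    have a2 := Nat.mul_le_mul_right f' hc
    have a3 := Nat.mul_le_mul_right f'' (hc.trans hee'')
    lia
  -- The dihedral solution (2, 2, n) has f'' = 2.
  have h3 : e' ≠ 2 := by rintro rfl; lia
  obtain rfl : e' = 3 := by lia
  have h4 : e'' < 6 := by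
    by_contra! hc
    have a3 := Nat.mul_le_mul_right f'' hc
    lia
  interval_cases e'' <;> lia

lemma klein_equation {h e e' e'' f f' f'' : ℕ} (he : 2 ≤ e) (he' : 2 ≤ e') (he'' : 2 ≤ e'')
    (hf : e * f = h) (hf' : e' * f' = h) (hf'' : e'' * f'' = h)
    (h3 : 3 ≤ f) (h3' : 3 ≤ f') (h3'' : 3 ≤ f'')
    (hsum : f + f' + f'' = h + 2) : h = 12 ∨ h = 24 ∨ h = 60 := by
  rcases le_total e e' with h1 | h1 <;> rcases le_total e' e'' with h2 | h2 <;>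
    rcases le_total e e'' with h4 | h4
  · exact klein_equation_of_le he h1 h2 hf hf' hf'' h3'' (by lia)
  · exact klein_equation_of_le he h1 h2 hf hf' hf'' h3'' (by lia)
  · exact klein_equation_of_le he h4 h2 hf hf'' hf' h3' (by lia)
  · exact klein_equation_of_le he'' h4 h1 hf'' hf hf' h3' (by lia)
  · exact klein_equation_of_le he' h1 h4 hf' hf hf'' h3'' (by lia)
  · exact klein_equation_of_le he' h2 h4 hf' hf'' hf h3 (by lia)
  · exact klein_equation_of_le he'' h2 h1 hf'' hf' hf h3 (by lia)
  · exact klein_equation_of_le he'' h2 h1 hf'' hf' hf h3 (by lia)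

/-- The terms h - f sum to 2h - 2. Free orbits contribute 0 and every other orbit contributes
between h/2 and h - 3, so exactly three orbits are not free. -/
lemma klein_equation_finset {Ω : Type*} [Fintype Ω] {h : ℕ} (hh : 2 ≤ h) (e f : Ω → ℕ)
    (hef : ∀ ω, e ω * f ω = h) (hsum : ∑ ω, f ω + 2 * (h - 1) = Fintype.card Ω * h) :
    (∃ ω, f ω ≤ 2) ∨ h = 12 ∨ h = 24 ∨ h = 60 := by
  classical
  by_cases hf : ∃ ω, f ω ≤ 2
  · exact Or.inl hf
  push Not at hf
  right
  have he0 : ∀ ω, e ω ≠ 0 := fun ω h0 => by have := hef ω; simp [h0] at this; lia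
  set S := Finset.univ.filter fun ω => 2 ≤ e ω with hS
  have hsum' : ∑ ω, ((h : ℤ) - f ω) = 2 * h - 2 := by
    rw [Finset.sum_sub_distrib, Finset.sum_const, Finset.card_univ, nsmul_eq_mul]
    have : (∑ ω, (f ω : ℤ)) + 2 * (h - 1) = Fintype.card Ω * h := by
      have := congrArg (Nat.cast : ℕ → ℤ) hsum
      push_cast [Nat.cast_sub (show 1 ≤ h by lia)] at this
      exact this
    linarith
  have hsumS : ∑ ω ∈ S, ((h : ℤ) - f ω) = 2 * h - 2 := by
    rw [← hsum']
    apply Finset.sum_subset (Finset.subset_univ _)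
    intro ω _ hω
    have : e ω = 1 := by
      have := he0 ω
      simp [hS] at hω
      lia
    have h2 := hef ω
    rw [this, one_mul] at h2
    simp [h2]
  have hlow : ∀ ω ∈ S, (h : ℤ) ≤ 2 * ((h : ℤ) - f ω) := fun ω hω => by
    have h2 := hef ω
    have := Nat.mul_le_mul_right (f ω) (Finset.mem_filter.mp hω).2
    lia
  have hup : ∀ ω ∈ S, (h : ℤ) - f ω ≤ h - 3 := fun ω _ => by
    have := hf ω
    lia
  have h1 := Finset.card_nsmul_le_sum S _ _ hlow
  rw [← Finset.mul_sum, hsumS, nsmul_eq_mul] at h1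
  have h2 := Finset.sum_le_card_nsmul S _ _ hup
  rw [hsumS, nsmul_eq_mul] at h2
  have hc1 : S.card ≤ 3 := by
    by_contra! hc
    have : (4 : ℤ) * h ≤ S.card * h := by gcongr; exact_mod_cast hc
    linarith
  have hc2 : 3 ≤ S.card := by
    by_contra! hc
    interval_cases S.card <;> lia
  obtain ⟨x, y, z, hxy, hxz, hyz, hxyz⟩ := Finset.card_eq_three.mp (le_antisymm hc1 hc2)
  have hmem : ∀ ω ∈ S, 2 ≤ e ω := fun ω hω => (Finset.mem_filter.mp hω).2
  rw [hxyz] at hsumS hmem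
  rw [Finset.sum_insert (by simp [hxy, hxz]), Finset.sum_insert (by simp [hyz]),
    Finset.sum_singleton] at hsumS
  exact klein_equation (hmem x (by simp)) (hmem y (by simp)) (hmem z (by simp)) (hef x) (hef y)
    (hef z) (hf x) (hf y) (hf z) (by lia)

/-- Klein's classification of orders: if every nontrivial element of a finite group has exactly two
fixed points, then the order is `12`, `24` or `60`, or some stabilizer has index at most two. -/
theorem exists_stabilizer_index_le_two_or_card {G X : Type*} [Group G] [Finite G] [Finite X]
    [Nontrivial G] [MulAction G X] (hfix : ∀ g : G, g ≠ 1 → (MulAction.fixedBy X g).ncard = 2) :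
    (∃ x : X, Nat.card G = Nat.card (MulAction.stabilizer G x) ∨
      Nat.card G = 2 * Nat.card (MulAction.stabilizer G x)) ∨
    Nat.card G = 12 ∨ Nat.card G = 24 ∨ Nat.card G = 60 := by
  classical
  have := Fintype.ofFinite G
  have := Fintype.ofFinite X
  have burnside := MulAction.sum_card_fixedBy_eq_card_orbits_mul_card_group G X
  have hX : Fintype.card X = ∑ ω : MulAction.orbitRel.Quotient G X,
      Fintype.card (MulAction.orbit G ω.out) := by
    rw [← Fintype.card_sigma, Fintype.card_congr (MulAction.selfEquivSigmaOrbits G X)]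
  have hcard : ∑ g : G, Fintype.card (MulAction.fixedBy X g) =
      Fintype.card X + 2 * (Fintype.card G - 1) := by
    rw [← Finset.add_sum_erase _ _ (Finset.mem_univ 1)]
    congr 1
    · simp [← Nat.card_eq_fintype_card]
    · rw [Finset.sum_congr rfl (g := fun _ => 2), Finset.sum_const, Finset.card_erase_of_mem
        (Finset.mem_univ _), Finset.card_univ, smul_eq_mul, mul_comm]
      intro g hg
      rw [← hfix g (Finset.ne_of_mem_erase hg), ← Nat.card_eq_fintype_card, Nat.card_coe_set_eq]
  rw [hcard, hX] at burnside
  have horb : ∀ x : X, Fintype.card (MulAction.stabilizer G x) *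
      Fintype.card (MulAction.orbit G x) = Fintype.card G := fun x => by
    rw [mul_comm, MulAction.card_orbit_mul_card_stabilizer_eq_card_group]
  simp only [Nat.card_eq_fintype_card]
  rcases klein_equation_finset Fintype.one_lt_card
    (fun ω : MulAction.orbitRel.Quotient G X => Fintype.card (MulAction.stabilizer G ω.out))
    (fun ω => Fintype.card (MulAction.orbit G ω.out)) (fun ω => horb _) burnside with ⟨ω, hω⟩ | h
  · refine Or.inl ⟨ω.out, ?_⟩
    have h1 := horb ω.out
    have h0 : 0 < Fintype.card (MulAction.orbit G ω.out) :=
      Fintype.card_pos_iff.mpr ⟨⟨_, MulAction.mem_orbit_self _⟩⟩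
    replace hω : Fintype.card (MulAction.orbit G ω.out) ≤ 2 := hω
    interval_cases Fintype.card (MulAction.orbit G ω.out) <;> lia
  · exact Or.inr h

/-! ### Elements of trace ±2 -/

open Matrix

/-- The discriminant vanishes, so A differs from the scalar tr(A)/2 by a commuting nilpotent, which
the p-th power kills. -/
lemma Matrix.scalar_pow_char_of_trace_sq_eq_four {p : ℕ} [Fact p.Prime] (hp : p ≠ 2)
    (g : SL(2, ZMod p)) (hg : (g : Matrix (Fin 2) (Fin 2) (ZMod p)).trace ^ 2 = 4) :
    (g : Matrix (Fin 2) (Fin 2) (ZMod p)) ^ p =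
      scalar (Fin 2) ((g : Matrix (Fin 2) (Fin 2) (ZMod p)).trace / 2) := by
  have h2 : NeZero (2 : ZMod p) := ⟨Ring.two_ne_zero (by rwa [ZMod.ringChar_zmod_n])⟩
  set A := (g : Matrix (Fin 2) (Fin 2) (ZMod p)) with hA
  set c := scalar (Fin 2) (A.trace / 2) with hc
  have hn : (A - c) ^ 2 = 0 := by
    rw [hc, sub_scalar_sq_eq_discr, discr_fin_two, hg, hA, g.det_coe]
    simp
  have hcomm : Commute (A - c) c := (scalar_commute _ (fun _ => Commute.all _ _) _).symm
  have hnp : (A - c) ^ p = 0 := pow_eq_zero_of_le (Fact.out : p.Prime).two_le hn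
  have := add_pow_char_of_commute p hcomm
  rw [sub_add_cancel, hnp, zero_add, hc, ← map_pow, ZMod.pow_card] at this
  exact this

/-- A matrix in `SL(2, p)` with trace `±2` has order dividing `p` modulo the center. -/
lemma Matrix.SpecialLinearGroup.pow_char_mem_center {p : ℕ} [Fact p.Prime] (hp : p ≠ 2)
    (g : SL(2, ZMod p)) (hg : (g : Matrix (Fin 2) (Fin 2) (ZMod p)).trace ^ 2 = 4) :
    g ^ p ∈ Subgroup.center SL(2, ZMod p) := by
  have h2 : (2 : ZMod p) ≠ 0 := Ring.two_ne_zero (by rwa [ZMod.ringChar_zmod_n])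
  rw [SpecialLinearGroup.mem_center_iff]
  refine ⟨_, ?_, (scalar_pow_char_of_trace_sq_eq_four hp g hg).symm⟩
  rw [Fintype.card_fin, div_pow, hg, div_eq_one_iff_eq (pow_ne_zero 2 h2)]
  norm_num

lemma Matrix.SpecialLinearGroup.pow_char_eq_one {p : ℕ} [Fact p.Prime] (hp : p ≠ 2)
    (g : SL(2, ZMod p)) (hg : (g : Matrix (Fin 2) (Fin 2) (ZMod p)).trace = 2) : g ^ p = 1 := by
  have h2 : (2 : ZMod p) ≠ 0 := Ring.two_ne_zero (by rwa [ZMod.ringChar_zmod_n])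
  ext1
  have := scalar_pow_char_of_trace_sq_eq_four hp g (by rw [hg]; norm_num)
  rw [hg, div_self h2, map_one] at this
  rw [SpecialLinearGroup.coe_pow, this, SpecialLinearGroup.coe_one]

/-! ### Fixed points and stabilizers on the projective line -/

open OnePoint

/-- An element of `GL(2, K)` whose discriminant is a nonzero square has exactly two fixed points on
the projective line. -/
lemma Matrix.GeneralLinearGroup.ncard_fixedBy_of_discr_eq {K : Type*} [Field K] [DecidableEq K]
    [NeZero (2 : K)] (g : GL (Fin 2) K) {s : K} (hs : s ≠ 0)
    (hg : (g : Matrix (Fin 2) (Fin 2) K).discr = s * s) :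
    (MulAction.fixedBy (OnePoint K) g).ncard = 2 := by
  have h2 : (2 : K) ≠ 0 := two_ne_zero
  rw [discr_fin_two, trace_fin_two, det_fin_two] at hg
  have hfin : ∀ z : K, g • (z : OnePoint K) = z ↔
      g 1 0 * (z * z) + (g 1 1 - g 0 0) * z + -g 0 1 = 0 := fun z => by
    rw [← fixpointPolynomial_aeval_eq_zero_iff]
    simp [fixpointPolynomial, sq, sub_eq_add_neg]
  rw [Set.ncard_eq_two]
  -- If ∞ is fixed, the fixed point equation is linear; otherwise it is a quadratic with
  -- discriminant s².
  by_cases hc : g 1 0 = 0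
  · have hne : g 1 1 - g 0 0 ≠ 0 := fun h => hs (mul_self_eq_zero.mp (by
      rw [← hg, hc, sub_eq_zero.mp h]; ring))
    refine ⟨∞, ((g 0 1 / (g 1 1 - g 0 0) : K) : OnePoint K), infty_ne_coe _, ?_⟩
    ext x
    cases x with
    | infty => simp [smul_infty_eq_self_iff, hc]
    | coe z =>
      simp only [MulAction.mem_fixedBy, hfin, hc, Set.mem_insert_iff, coe_ne_infty,
        Set.mem_singleton_iff, coe_eq_coe, false_or, eq_div_iff hne]
      constructor <;> intro h <;> linear_combination h
  · have hd : discrim (g 1 0) (g 1 1 - g 0 0) (-g 0 1) = s * s := by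
      rw [discrim, ← hg]; ring
    refine ⟨(((-(g 1 1 - g 0 0) + s) / (2 * g 1 0) : K) : OnePoint K),
      (((-(g 1 1 - g 0 0) - s) / (2 * g 1 0) : K) : OnePoint K), ?_, ?_⟩
    · rw [Ne, coe_eq_coe, div_left_inj' (mul_ne_zero h2 hc)]
      intro h
      exact mul_ne_zero h2 hs (by linear_combination h)
    · ext x
      cases x with
      | infty => simp [smul_infty_eq_self_iff, hc]
      | coe z =>
        simp only [MulAction.mem_fixedBy, hfin, Set.mem_insert_iff, Set.mem_singleton_iff,
          coe_eq_coe]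
        exact quadratic_eq_zero_iff hc hd z

lemma OnePoint.exists_smul_infty_eq {K : Type*} [Field K] [DecidableEq K] (x : OnePoint K) :
    ∃ k : GL (Fin 2) K, k • (∞ : OnePoint K) = x := by
  cases x with
  | infty => exact ⟨1, one_smul _ _⟩
  | coe z =>
    refine ⟨GeneralLinearGroup.mkOfDetNeZero !![z, -1; 1, 0] (by simp), ?_⟩
    simp [smul_infty_eq_ite, GeneralLinearGroup.mkOfDetNeZero]

/-- The homomorphism `SL(2, F) → GL(2, K)` induced by a field extension `K / F`. -/
noncomputable def Matrix.SpecialLinearGroup.toExtensionGL (F K : Type*) [Field F] [Field K]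
    [Algebra F K] : SL(2, F) →* GL (Fin 2) K :=
  SpecialLinearGroup.toGL.comp (SpecialLinearGroup.map (algebraMap F K))

lemma Matrix.SpecialLinearGroup.toExtensionGL_apply {F K : Type*} [Field F] [Field K]
    [Algebra F K] (g : SL(2, F)) :
    (toExtensionGL F K g : Matrix (Fin 2) (Fin 2) K) =
      (g : Matrix (Fin 2) (Fin 2) F).map (algebraMap F K) := rfl

/-- The eigenvalue on the first basis vector, for a group acting by matrices that
become upper triangular after conjugation by `k`. -/
def Matrix.GeneralLinearGroup.conjEigenvalue {K T : Type*} [Field K] [DecidableEq K] [Group T]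
    (ψ : T →* GL (Fin 2) K) (k : GL (Fin 2) K)
    (hk : ∀ t, (k⁻¹ * ψ t * k) 1 0 = 0) : T →* K where
  toFun t := (k⁻¹ * ψ t * k) 0 0
  map_one' := by simp
  map_mul' s t := by
    have h : k⁻¹ * ψ (s * t) * k = (k⁻¹ * ψ s * k) * (k⁻¹ * ψ t * k) := by
      rw [map_mul]; group
    rw [h, GeneralLinearGroup.coe_mul, mul_apply, Fin.sum_univ_two, hk t, mul_zero, add_zero]

/-- A `p'`-subgroup of `SL(2, p)` fixing a point of the projective line over some extension field
has order dividing `p - 1` or `p + 1`. -/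
theorem Matrix.SpecialLinearGroup.card_dvd_of_fixes {p : ℕ} [Fact p.Prime] (hp : p ≠ 2)
    {K : Type*} [Field K] [DecidableEq K] [Algebra (ZMod p) K] (T : Subgroup SL(2, ZMod p))
    (hT : (Nat.card T).Coprime p) (x : OnePoint K)
    (hx : ∀ t ∈ T, toExtensionGL (ZMod p) K t • x = x) :
    Nat.card T ∣ p - 1 ∨ Nat.card T ∣ p + 1 := by
  obtain ⟨k, rfl⟩ := exists_smul_infty_eq x
  have hcp : CharP K p := charP_of_injective_algebraMap (algebraMap (ZMod p) K).injective p
  set ψ : T →* GL (Fin 2) K := (toExtensionGL (ZMod p) K).comp T.subtype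
  have hk : ∀ t, (k⁻¹ * ψ t * k) 1 0 = 0 := fun t => by
    rw [← smul_infty_eq_self_iff, mul_smul, mul_smul, inv_smul_eq_iff]
    exact hx t t.2
  set l := GeneralLinearGroup.conjEigenvalue ψ k hk
  have htr : ∀ t : T, l t + (k⁻¹ * ψ t * k) 1 1 =
      algebraMap (ZMod p) K (trace (t : SL(2, ZMod p)).1) := by
    intro t
    have h1 : trace (k⁻¹ * ψ t * k).1 = trace (ψ t).1 := by
      rw [GeneralLinearGroup.coe_mul, trace_mul_comm, ← GeneralLinearGroup.coe_mul]
      congr 2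
      group
    rw [trace_fin_two] at h1
    refine h1.trans ?_
    rw [show (ψ t).1 = (t : SL(2, ZMod p)).1.map (algebraMap (ZMod p) K) from rfl,
      trace_fin_two, trace_fin_two, map_add]
    rfl
  have hdet : ∀ t : T, l t * (k⁻¹ * ψ t * k) 1 1 = 1 := by
    intro t
    have h1 : det (k⁻¹ * ψ t * k).1 = det (ψ t).1 := by
      rw [GeneralLinearGroup.coe_mul, det_mul_comm, ← GeneralLinearGroup.coe_mul]
      congr 2
      group
    have h2 : det (ψ t).1 = 1 := (SpecialLinearGroup.map (algebraMap (ZMod p) K) t.1).2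
    rw [h2, det_fin_two, hk t, mul_zero, sub_zero] at h1
    exact h1
  -- Eigenvalue 1 and determinant 1 force trace 2, hence t ^ p = 1.
  have hinj : Function.Injective l := by
    rw [injective_iff_map_eq_one]
    intro t ht
    have h1 := hdet t
    have h2 := htr t
    rw [ht, one_mul] at h1
    rw [ht, h1, one_add_one_eq_two, ← map_ofNat (algebraMap (ZMod p) K) 2] at h2
    have h3 := pow_char_eq_one hp t.1 ((algebraMap (ZMod p) K).injective h2).symm
    have h4 : t ^ p = 1 := Subtype.ext h3
    rw [← orderOf_eq_one_iff]
    exact Nat.eq_one_of_dvd_coprimes hT (orderOf_dvd_natCard t) (orderOf_dvd_of_pow_eq_one h4)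
  have hcyc : IsCyclic T := isCyclic_of_injective_ringHom l hinj
  obtain ⟨g, hg⟩ := IsCyclic.exists_generator (α := T)
  rw [← orderOf_eq_card_of_forall_mem_zpowers hg, ← orderOf_injective l hinj]
  -- Frobenius fixes the trace and the determinant, so it sends the eigenvalue λ to λ or λ⁻¹.
  have hfrob : l g ^ p + (k⁻¹ * ψ g * k) 1 1 ^ p = l g + (k⁻¹ * ψ g * k) 1 1 := by
    rw [← add_pow_char, htr, ← map_pow, ZMod.pow_card]
  have hd := hdet g
  have hdp : l g ^ p * (k⁻¹ * ψ g * k) 1 1 ^ p = 1 := by rw [← mul_pow, hd, one_pow]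
  have hl0 : l g ≠ 0 := left_ne_zero_of_mul_eq_one hd
  have hkey : (l g ^ p - l g) * (l g ^ p * l g - 1) = 0 := by
    linear_combination (l g ^ p * l g) * hfrob - l g * hdp + l g ^ p * hd
  rcases mul_eq_zero.mp hkey with h | h
  · left
    rw [orderOf_dvd_iff_pow_eq_one]
    apply mul_right_cancel₀ hl0
    rw [← pow_succ, Nat.sub_add_cancel (Fact.out : p.Prime).one_le, one_mul]
    exact sub_eq_zero.mp h
  · right
    rw [orderOf_dvd_iff_pow_eq_one, pow_succ]
    exact sub_eq_zero.mp h

/-! ### Orders of SL(2, p) and PSL(2, p) -/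

lemma Matrix.SpecialLinearGroup.card_center_two {p : ℕ} [Fact p.Prime] (hp : p ≠ 2) :
    Nat.card (Subgroup.center SL(2, ZMod p)) = 2 := by
  rw [Nat.card_congr (center_equiv_rootsOfUnity' (0 : Fin 2)).toEquiv, Fintype.card_fin]
  exact (IsPrimitiveRoot.neg_one (R := ZMod p) p hp).card_rootsOfUnity

lemma Matrix.SpecialLinearGroup.card_two_mul {p : ℕ} [Fact p.Prime] :
    Nat.card SL(2, ZMod p) * (p - 1) = (p ^ 2 - 1) * (p ^ 2 - p) := by
  have hsurj : Function.Surjective (GeneralLinearGroup.det : GL (Fin 2) (ZMod p) →* (ZMod p)ˣ) := by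
    intro u
    refine ⟨GeneralLinearGroup.mkOfDetNeZero !![(u : ZMod p), 0; 0, 1] (by simp), ?_⟩
    ext
    simp [GeneralLinearGroup.mkOfDetNeZero]
  have hker : Nat.card SL(2, ZMod p) =
      Nat.card (GeneralLinearGroup.det : GL (Fin 2) (ZMod p) →* (ZMod p)ˣ).ker := by
    refine Nat.card_congr (Equiv.ofBijective
      (fun g => ⟨SpecialLinearGroup.toGL g, ?_⟩) ⟨?_, ?_⟩)
    · rw [MonoidHom.mem_ker]; ext; exact g.2
    · intro g h hgh
      exact Subtype.ext (congrArg (fun x => x.1.1) hgh)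
    · rintro ⟨g, hg⟩
      exact ⟨⟨g.1, congrArg Units.val hg⟩, Subtype.ext (Units.ext rfl)⟩
  have h := card_GL_field (𝔽 := ZMod p) 2
  rw [Fin.prod_univ_two, ZMod.card, ← Subgroup.card_mul_index
    (GeneralLinearGroup.det : GL (Fin 2) (ZMod p) →* (ZMod p)ˣ).ker, Subgroup.index_ker,
    MonoidHom.range_eq_top.mpr hsurj, Subgroup.card_top, Nat.card_eq_fintype_card (α := (ZMod p)ˣ),
    ZMod.card_units, ← hker] at h
  simpa using h

lemma Matrix.ProjectiveSpecialLinearGroup.two_mul_card {p : ℕ} [Fact p.Prime] (hp : p ≠ 2) :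
    2 * Nat.card PSL(2, ZMod p) = p * (p - 1) * (p + 1) := by
  have h1 := (Subgroup.center SL(2, ZMod p)).card_eq_card_quotient_mul_card_subgroup
  rw [SpecialLinearGroup.card_center_two hp] at h1
  have h2 := SpecialLinearGroup.card_two_mul (p := p)
  have h0 : 0 < p - 1 := Nat.sub_pos_of_lt (Fact.out : p.Prime).one_lt
  apply Nat.eq_of_mul_eq_mul_right h0
  rw [mul_comm 2, ← h1, h2]
  obtain ⟨q, rfl⟩ : ∃ q, p = q + 1 := ⟨p - 1, by lia⟩
  have e1 : (q + 1) ^ 2 - 1 = q * (q + 2) := by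
    rw [show (q + 1) ^ 2 = q * (q + 2) + 1 by ring]; rfl
  have e2 : (q + 1) ^ 2 - (q + 1) = q * (q + 1) := by
    rw [show (q + 1) ^ 2 = q * (q + 1) + (q + 1) by ring, Nat.add_sub_cancel]
  rw [e1, e2, Nat.add_sub_cancel]
  ring

/-! ### Subgroups of PSL(2, p) of order prime to p -/

/-- The action of `PSL(2, F)` on the projective line over an extension field `K`. -/
noncomputable def Matrix.ProjectiveSpecialLinearGroup.toPermLine (F K : Type*) [Field F] [Field K]
    [Algebra F K] [DecidableEq K] : PSL(2, F) →* Equiv.Perm (OnePoint K) :=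
  QuotientGroup.lift _
    ((MulAction.toPermHom (GL (Fin 2) K) (OnePoint K)).comp
      (SpecialLinearGroup.toExtensionGL F K)) <| by
    intro g hg
    obtain ⟨r, hr, hg⟩ := SpecialLinearGroup.mem_center_iff.mp hg
    have h10 : (SpecialLinearGroup.toExtensionGL F K g) 1 0 = 0 := by
      rw [SpecialLinearGroup.toExtensionGL_apply, ← hg]; simp
    have h01 : (SpecialLinearGroup.toExtensionGL F K g) 0 1 = 0 := by
      rw [SpecialLinearGroup.toExtensionGL_apply, ← hg]; simp
    have h00 : (SpecialLinearGroup.toExtensionGL F K g) 0 0 = algebraMap F K r := by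
      rw [SpecialLinearGroup.toExtensionGL_apply, ← hg]; simp
    have h11 : (SpecialLinearGroup.toExtensionGL F K g) 1 1 = algebraMap F K r := by
      rw [SpecialLinearGroup.toExtensionGL_apply, ← hg]; simp
    have hr0 : algebraMap F K r ≠ 0 := by
      rw [Ne, map_eq_zero]
      rintro rfl
      simp at hr
    rw [MonoidHom.mem_ker]
    ext x
    simp only [MonoidHom.comp_apply, MulAction.toPermHom_apply, MulAction.toPerm_apply,
      Equiv.Perm.one_apply]
    cases x with
    | infty => rw [smul_infty_eq_self_iff, h10]
    | coe z => simp [smul_some_eq_ite, h10, h01, h00, h11, hr0]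

lemma Matrix.ProjectiveSpecialLinearGroup.toPermLine_mk {F K : Type*} [Field F] [Field K]
    [Algebra F K] [DecidableEq K] (g : SL(2, F)) (x : OnePoint K) :
    toPermLine F K (g : PSL(2, F)) x = SpecialLinearGroup.toExtensionGL F K g • x := rfl

/-- Every element of `ZMod p` becomes a square in the field with `p ^ 2` elements. -/
lemma GaloisField.isSquare_algebraMap {p : ℕ} [Fact p.Prime] (hp : p ≠ 2) (a : ZMod p) :
    IsSquare (algebraMap (ZMod p) (GaloisField p 2) a) := by
  rcases eq_or_ne a 0 with rfl | ha
  · simp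
  have := Fintype.ofFinite (GaloisField p 2)
  have hodd : p % 2 = 1 := (Fact.out : p.Prime).eq_two_or_odd.resolve_left hp
  rw [FiniteField.isSquare_iff (by rwa [ringChar.eq (GaloisField p 2) p])
    (by rwa [Ne, map_eq_zero]), ← Nat.card_eq_fintype_card, GaloisField.card p 2 two_ne_zero]
  obtain ⟨n, hn⟩ : ∃ n, p = 2 * n + 1 := ⟨p / 2, by lia⟩
  -- The exponent in Euler's criterion is a multiple of p - 1, so Fermat applies.
  have : p ^ 2 / 2 = (p - 1) * (n + 1) := by
    have : p ^ 2 = 2 * ((p - 1) * (n + 1)) + 1 := by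
      rw [hn, Nat.add_sub_cancel]; ring
    lia
  rw [this, ← map_pow, pow_mul, ZMod.pow_card_sub_one_eq_one ha, one_pow, map_one]

lemma Matrix.ProjectiveSpecialLinearGroup.ncard_fixedPoints {p : ℕ} [Fact p.Prime] (hp : p ≠ 2)
    [DecidableEq (GaloisField p 2)] (h : PSL(2, ZMod p)) (hord : (orderOf h).Coprime p)
    (h1 : h ≠ 1) : {x | toPermLine (ZMod p) (GaloisField p 2) h x = x}.ncard = 2 := by
  obtain ⟨g, rfl⟩ := QuotientGroup.mk_surjective h
  have htr : trace g.1 ^ 2 ≠ 4 := by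
    intro htr
    have hpow := (QuotientGroup.eq_one_iff _).mpr (SpecialLinearGroup.pow_char_mem_center hp g htr)
    rw [QuotientGroup.mk_pow] at hpow
    exact h1 (orderOf_eq_one_iff.mp
      (Nat.eq_one_of_dvd_coprimes hord dvd_rfl (orderOf_dvd_of_pow_eq_one hpow)))
  obtain ⟨s, hs⟩ := GaloisField.isSquare_algebraMap hp (g.1.discr)
  have hdisc : g.1.discr ≠ 0 := by
    rw [discr_fin_two, g.det_coe, mul_one]
    exact sub_ne_zero.mpr htr
  have hs0 : s ≠ 0 := by
    rintro rfl
    rw [mul_zero, map_eq_zero] at hs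
    exact hdisc hs
  have h2 : NeZero (2 : GaloisField p 2) :=
    ⟨Ring.two_ne_zero (by rwa [ringChar.eq (GaloisField p 2) p])⟩
  refine GeneralLinearGroup.ncard_fixedBy_of_discr_eq
    (SpecialLinearGroup.toExtensionGL (ZMod p) (GaloisField p 2) g) hs0 ?_
  rw [← hs, SpecialLinearGroup.toExtensionGL_apply, discr_fin_two, discr_fin_two, trace_fin_two,
    trace_fin_two, det_fin_two, det_fin_two]
  simp only [map_apply, map_sub, map_pow, map_add, map_mul, map_ofNat]

lemma Subgroup.card_comap_mk' {G : Type*} [Group G] (N : Subgroup G) [N.Normal]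
    (H : Subgroup (G ⧸ N)) :
    Nat.card (H.comap (QuotientGroup.mk' N)) = Nat.card N * Nat.card H := by
  rw [← Nat.card_prod]
  exact Nat.card_congr (QuotientGroup.preimageMkEquivSubgroupProdSet N (H : Set (G ⧸ N)))

/-- The orders of `p'`-subgroups of `PSL(2, p)`. -/
theorem Matrix.ProjectiveSpecialLinearGroup.card_subgroup {p : ℕ} [Fact p.Prime] (hp : p ≠ 2)
    (H : Subgroup PSL(2, ZMod p)) (hH : (Nat.card H).Coprime p) :
    Nat.card H ∣ p - 1 ∨ Nat.card H ∣ p + 1 ∨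
      Nat.card H = 12 ∨ Nat.card H = 24 ∨ Nat.card H = 60 := by
  classical
  rcases subsingleton_or_nontrivial H with hs | hn
  · exact Or.inl (by rw [Nat.card_of_subsingleton (1 : H)]; exact one_dvd _)
  have hfinite : Finite (OnePoint (GaloisField p 2)) := inferInstanceAs (Finite (Option _))
  let : MulAction H (OnePoint (GaloisField p 2)) :=
    MulAction.compHom _ ((toPermLine (ZMod p) (GaloisField p 2)).comp H.subtype)
  have hsmul : ∀ (h : H) (x : OnePoint (GaloisField p 2)),
    h • x = toPermLine (ZMod p) (GaloisField p 2) h x := fun _ _ => rfl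
  have hfix : ∀ h : H, h ≠ 1 → (MulAction.fixedBy (OnePoint (GaloisField p 2)) h).ncard = 2 :=
    fun h h1 => ncard_fixedPoints hp h.1
      (hH.coprime_dvd_left (by rw [Subgroup.orderOf_coe]; exact orderOf_dvd_natCard h))
      (by simpa using h1)
  rcases exists_stabilizer_index_le_two_or_card hfix with ⟨x, hx⟩ | h
  · set S := (MulAction.stabilizer H x).map H.subtype
    have hS : Nat.card S = Nat.card (MulAction.stabilizer H x) :=
      Nat.card_congr ((MulAction.stabilizer H x).equivMapOfInjective _
        H.subtype_injective).symm.toEquiv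
    have hT := Subgroup.card_comap_mk' (Subgroup.center SL(2, ZMod p)) S
    rw [hS, SpecialLinearGroup.card_center_two hp] at hT
    have hp2 : Nat.Coprime 2 p := (Nat.coprime_primes Nat.prime_two Fact.out).mpr hp.symm
    have hdvd := SpecialLinearGroup.card_dvd_of_fixes hp
      (S.comap (QuotientGroup.mk' (Subgroup.center SL(2, ZMod p))))
      (by
        rw [hT]
        exact hp2.mul_left (hH.coprime_dvd_left (Subgroup.card_subgroup_dvd_card _))) x (by
        intro t ht
        obtain ⟨h, hh, hht⟩ := ht
        rw [← toPermLine_mk]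
        rw [SetLike.mem_coe, MulAction.mem_stabilizer_iff, hsmul] at hh
        have hht' : (h : PSL(2, ZMod p)) = (t : PSL(2, ZMod p)) := hht
        rwa [hht'] at hh)
    rw [hT] at hdvd
    -- The factor 2 from the center absorbs a stabilizer index of 2.
    have hdiv : Nat.card H ∣ 2 * Nat.card (MulAction.stabilizer H x) := by
      rcases hx with hx | hx
      · exact ⟨2, by rw [hx, mul_comm]⟩
      · exact hx ▸ dvd_rfl
    exact hdvd.imp hdiv.trans fun h => Or.inl (hdiv.trans h)
  · exact Or.inr (Or.inr h)

/-! ### Choice of the prime -/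

lemma exists_prime_hall_conditions {a b : ℕ} (ha : 2 < a) (hb : 2 < b) (hab : a.Coprime b) :
    ∃ p s t : ℕ, p.Prime ∧ 2 < p ∧ p - 1 = a * (1 + a * s) ∧ p + 1 = b * (1 + b * t) := by
  have hco : (a ^ 2).Coprime (b ^ 2) := hab.pow 2 2
  obtain ⟨c, hca, hcb⟩ := Nat.chineseRemainder hco (1 + a) (b - 1)
  have hc1 : Nat.Coprime c (a ^ 2) := by
    rw [Nat.Coprime, hca.gcd_eq]
    exact Nat.Coprime.pow_right 2 (by simp)
  have hc2 : Nat.Coprime c (b ^ 2) := by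
    rw [Nat.Coprime, hcb.gcd_eq]
    refine Nat.Coprime.pow_right 2 ?_
    obtain ⟨d, rfl⟩ : ∃ d, b = d + 1 := ⟨b - 1, by lia⟩
    simp
  -- The lower bound keeps the natural number subtractions p - (1 + a) and p - (b - 1) exact.
  obtain ⟨p, hgt, hp, hpc⟩ := Nat.forall_exists_prime_gt_and_modEq (1 + a + b)
    (by positivity : a ^ 2 * b ^ 2 ≠ 0) (hc1.mul_right hc2)
  have hpa : 1 + a ≡ p [MOD a ^ 2] := ((hpc.of_mul_right _).trans hca).symm
  have hpb : b - 1 ≡ p [MOD b ^ 2] := ((hpc.of_mul_left _).trans hcb).symm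
  obtain ⟨s, hs⟩ := (Nat.modEq_iff_dvd' (by lia)).mp hpa
  obtain ⟨t, ht⟩ := (Nat.modEq_iff_dvd' (by lia)).mp hpb
  refine ⟨p, s, t, hp, by lia, ?_, ?_⟩
  · rw [show a * (1 + a * s) = a + a ^ 2 * s by ring, ← hs]; lia
  · rw [show b * (1 + b * t) = b + b ^ 2 * t by ring, ← ht]; lia

lemma coprime_one_add_mul (a s : ℕ) : a.Coprime (1 + a * s) := by simp

/-- The case of the theorem in which the second coprime factor is odd. -/
lemma exists_prime_hallDivisor_not_card_subgroup {a b : ℕ} (ha : 2 < a) (hb : 2 < b)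
    (hab : a.Coprime b) (hbodd : Odd b) (ha4 : Odd a ∨ 4 ∣ a)
    (h12 : a * b ≠ 12) (h24 : a * b ≠ 24) (h60 : a * b ≠ 60) :
    ∃ p : ℕ, p.Prime ∧ IsHallDivisor (a * b) (Nat.card PSL(2, ZMod p)) ∧
      ¬ ∃ H : Subgroup PSL(2, ZMod p), Nat.card H = a * b := by
  obtain ⟨p, s, t, hp, hp2, hs, ht⟩ := exists_prime_hall_conditions ha hb hab
  have : Fact p.Prime := ⟨hp⟩
  have hcard := ProjectiveSpecialLinearGroup.two_mul_card (p := p) hp2.ne'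
  have hodd : Odd p := hp.odd_of_ne_two hp2.ne'
  have hap : a.Coprime p := by
    rw [show p = 1 + a * (1 + a * s) by lia]; exact coprime_one_add_mul _ _
  have hbp : b.Coprime p := (show (p + 1).Coprime p by simp).coprime_dvd_left ⟨_, ht⟩
  have hgcd : ∀ d, d ∣ p - 1 → d ∣ p + 1 → d ∣ 2 := fun d h1 h2 => by
    have := Nat.dvd_sub h2 h1
    rwa [show p + 1 - (p - 1) = 2 by lia] at this
  -- The 2 dividing p(p - 1)(p + 1) is taken from the cofactor of b in p + 1, which is even since b
  -- is odd.
  obtain ⟨u, hu⟩ : 2 ∣ 1 + b * t := by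
    have : 2 ∣ b * (1 + b * t) := ht ▸ hodd.add_one.two_dvd
    exact (Nat.prime_two.dvd_mul.mp this).resolve_left hbodd.not_two_dvd_nat
  have hup : 2 * u ∣ p + 1 := ⟨b, by rw [ht, hu, mul_comm]⟩
  -- A common factor 2 would make both p - 1 and p + 1 divisible by 4.
  have hau : a.Coprime u := by
    have hd := hgcd (a.gcd u) ((Nat.gcd_dvd_left a u).trans ⟨_, hs⟩)
      ((Nat.gcd_dvd_right a u).trans ((dvd_mul_left u 2).trans hup))
    refine ((Nat.dvd_prime Nat.prime_two).mp hd).resolve_right fun h2 => ?_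
    have h2a : 2 ∣ a := h2 ▸ Nat.gcd_dvd_left a u
    have h2u : 2 ∣ u := h2 ▸ Nat.gcd_dvd_right a u
    have h4a : 4 ∣ p - 1 :=
      (ha4.resolve_left fun h => h.not_two_dvd_nat h2a).trans ⟨_, hs⟩
    have h4u : 4 ∣ p + 1 := (mul_dvd_mul_left 2 h2u).trans hup
    lia
  have hbs : b.Coprime (1 + a * s) := by
    have hd := hgcd (b.gcd (1 + a * s))
      ((Nat.gcd_dvd_right _ _).trans ⟨a, by rw [hs, mul_comm]⟩)
      ((Nat.gcd_dvd_left _ _).trans ⟨_, ht⟩)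
    exact ((Nat.dvd_prime Nat.prime_two).mp hd).resolve_right fun h2 =>
      hbodd.not_two_dvd_nat (h2 ▸ Nat.gcd_dvd_left _ _)
  have hbu : b.Coprime u :=
    (coprime_one_add_mul b t).coprime_dvd_right ⟨2, by rw [hu, mul_comm]⟩
  refine ⟨p, hp, ?_, ?_⟩
  · have hcard' : Nat.card PSL(2, ZMod p) = a * b * (p * (1 + a * s) * u) := by
      apply Nat.eq_of_mul_eq_mul_left two_pos
      rw [hcard, hs, ht, hu]
      ring
    rw [hcard']
    refine ⟨dvd_mul_right _ _, ?_⟩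
    rw [Nat.mul_div_cancel_left _ (by positivity)]
    exact Nat.Coprime.mul_left (((hap.mul_right (coprime_one_add_mul a s))).mul_right hau)
      ((hbp.mul_right hbs).mul_right hbu)
  · rintro ⟨H, hH⟩
    have := ProjectiveSpecialLinearGroup.card_subgroup hp2.ne' H (by rw [hH]; exact hap.mul_left hbp)
    rw [hH] at this
    rcases this with h | h | h | h | h
    · have := Nat.le_of_dvd two_pos (hgcd b ((dvd_mul_left b a).trans h) ⟨_, ht⟩)
      lia
    · have := Nat.le_of_dvd two_pos (hgcd a ⟨_, hs⟩ ((dvd_mul_right a b).trans h))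
      lia
    all_goals contradiction

/-- Split off the full power of one prime; a factor equal to 2 would make m twice an odd number. -/
lemma exists_coprime_factors_of_not_isPrimePow {m : ℕ} (hm : 0 < m)
    (hpow : ¬ ∃ p k : ℕ, p.Prime ∧ m = p ^ k) (h2 : ¬ (Even m ∧ Odd (m / 2))) :
    ∃ a b : ℕ, m = a * b ∧ 2 < a ∧ 2 < b ∧ Nat.gcd a b = 1 := by
  have hm1 : m ≠ 1 := fun h => hpow ⟨2, 0, Nat.prime_two, by simp [h]⟩
  obtain ⟨p, hp, hpm⟩ := Nat.exists_prime_and_dvd hm1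
  obtain ⟨k, b, hpb, hmb⟩ := Nat.exists_eq_pow_mul_and_not_dvd hm.ne' p hp.ne_one
  have hk : k ≠ 0 := by
    rintro rfl
    exact hpb (by simpa [hmb] using hpm)
  have hb0 : b ≠ 0 := by rintro rfl; simp at hpb
  have hb1 : b ≠ 1 := by
    rintro rfl
    exact hpow ⟨p, k, hp, by rw [hmb, mul_one]⟩
  have hcop : (p ^ k).Coprime b := ((hp.coprime_iff_not_dvd).mpr hpb).pow_left k
  have hne2 : ∀ c d : ℕ, m = c * d → c.Coprime d → c ≠ 2 := by
    rintro c d hcd hcop rfl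
    refine h2 ⟨⟨d, by lia⟩, ?_⟩
    rw [hcd, Nat.mul_div_cancel_left _ two_pos]
    exact Nat.coprime_two_left.mp hcop
  have ha2 := hne2 _ _ hmb hcop
  have hb2 := hne2 _ _ (hmb.trans (mul_comm _ _)) hcop.symm
  have ha1 : 1 < p ^ k := Nat.one_lt_pow hk hp.one_lt
  exact ⟨p ^ k, b, hmb, by lia, by lia, hcop⟩

lemma exists_prime_hallDivisor_not_card_subgroup_of_coprime (m a b : ℕ) (hm : m = a * b)
    (ha : 2 < a) (hb : 2 < b) (hab : Nat.gcd a b = 1) (h2 : ¬ (Even m ∧ Odd (m / 2)))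
    (h12 : m ≠ 12) (h24 : m ≠ 24) (h60 : m ≠ 60) :
    ∃ p : ℕ, p.Prime ∧ IsHallDivisor m (Nat.card PSL(2, ZMod p)) ∧
      ¬ ∃ H : Subgroup PSL(2, ZMod p), Nat.card H = m := by
  wlog hb_odd : Odd b generalizing a b with hwlog
  · have hb_even : Even b := Nat.not_odd_iff_even.mp hb_odd
    refine hwlog b a (hm.trans (mul_comm _ _)) hb ha (by rwa [Nat.gcd_comm]) ?_
    rw [← Nat.not_even_iff_odd]
    exact fun ha_even =>
      absurd (Nat.dvd_gcd ha_even.two_dvd hb_even.two_dvd) (by rw [hab]; decide)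
  have ha4 : Odd a ∨ 4 ∣ a := by
    refine or_iff_not_imp_left.mpr fun ha_odd => ?_
    obtain ⟨c, rfl⟩ := (Nat.not_odd_iff_even.mp ha_odd).two_dvd
    have hm2 : m / 2 = c * b := by rw [hm, mul_assoc, Nat.mul_div_cancel_left _ two_pos]
    have hcb : ¬ Odd (c * b) := fun h => h2 ⟨⟨c * b, by rw [hm]; ring⟩, hm2 ▸ h⟩
    have hc : Even c := Nat.not_odd_iff_even.mp fun hc => hcb (hc.mul hb_odd)
    exact mul_dvd_mul_left 2 hc.two_dvd
  subst hm
  exact exists_prime_hallDivisor_not_card_subgroup ha hb hab hb_odd ha4 h12 h24 h60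

theorem lemma3p2 :
    (∀ m a b : ℕ, m = a * b → 2 < a → 2 < b → Nat.gcd a b = 1 →
      ¬ (Even m ∧ Odd (m / 2)) →
      m ≠ 12 → m ≠ 24 → m ≠ 60 →
      ∃ p : ℕ, p.Prime ∧ IsHallDivisor m (Nat.card PSL(2, ZMod p)) ∧
        ¬ ∃ H : Subgroup PSL(2, ZMod p), Nat.card H = m) ∧
    (∀ m : ℕ, IsHallNumber m →
      (∃ p k : ℕ, p.Prime ∧ m = p ^ k) ∨
      (Even m ∧ Odd (m / 2)) ∨
      (m = 12 ∨ m = 24 ∨ m = 60)) := by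
  refine ⟨exists_prime_hallDivisor_not_card_subgroup_of_coprime, ?_⟩
  rintro m ⟨hm, hall⟩
  by_contra! ⟨hpow, h2, h12, h24, h60⟩
  obtain ⟨a, b, hmab, ha, hb, hab⟩ := exists_coprime_factors_of_not_isPrimePow hm
    (by push Not; exact hpow) (fun h => h2 h.1 h.2)
  obtain ⟨p, hp, hdiv, hno⟩ := exists_prime_hallDivisor_not_card_subgroup_of_coprime m a b hmab ha hb
    hab (fun h => h2 h.1 h.2) h12 h24 h60
  have : Fact p.Prime := ⟨hp⟩
  exact hno (hall _ hdiv)
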